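/- A literal is a Boolean variable $x$ or its negation $\bar x$. A clause is a finite set of literals that does not contain both $x$ and $\bar x$ for any variable $x$, and a CNF formula is a finite set of clauses. It is a $k$-CNF formula if every clause has exactly $k$ literals, and it is weakly linear if $|C\cap D|\le 1$ for any two distinct clauses $C,D$ of it (as sets of literals). If there is a unique literal $u$ with $u\in C$ and $\bar u\in D$, then $(C\setminus\{u\})\cup(D\setminus\{\bar u\})$ is called the resolvent of $C$ and $D$. A resolution tree for $F$ is a finite rooted tree, every inner vertex of which has exactly two children, whose vertices are labeled with clauses such that every leaf is labeled with a clause of $F$, the root is labeled with the empty clause, and the label of every inner vertex is the resolvent of the labels of its two children. $F$ is strictly treelike if it has a resolution tree in which no two leaves are labeled with the same clause. For real $a>0$ let $\mathrm{tower}_a(0)=1$ and $\mathrm{tower}_a(n+1)=a^{\mathrm{tower}_a(n)}$. For every real $\epsilon$ with $0<\epsilon<2$ there exists a constant $c\in\mathbb{N}$ such that for every $k\in\mathbb{N}$, every strictly treelike weakly linear $k$-CNF formula has at least $\mathrm{tower}_{2-\epsilon}(\max(k-c,0))$ clauses. -/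

import Mathlib

namespace LinearCNF

/-- A literal over the variable set `V`: `(x, true)` is the variable `x`,
`(x, false)` is its negation. -/
abbrev Literal (V : Type*) := V × Bool

/-- The complementary literal. -/
def Literal.compl {V : Type*} (u : Literal V) : Literal V := (u.1, !u.2)

/-- A clause: a finite set of literals that does not contain complementary literals. -/
@[ext]
structure Clause (V : Type*) where
  lits : Finset (Literal V)
  consistent : ∀ u ∈ lits, Literal.compl u ∉ lits

/-- A CNF formula: a finite set of clauses. -/
abbrev Formula (V : Type*) := Finset (Clause V)

/-- A `k`-CNF formula: every clause has exactly `k` literals. -/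
def Formula.IsKCNF {V : Type*} (F : Formula V) (k : ℕ) : Prop :=
  ∀ C ∈ F, C.lits.card = k

/-- Any two distinct clauses have at most one literal in common. -/
def Formula.IsWeaklyLinear {V : Type*} [DecidableEq V] (F : Formula V) : Prop :=
  ∀ C ∈ F, ∀ D ∈ F, C ≠ D → (C.lits ∩ D.lits).card ≤ 1

/-- `E` is the resolvent of `C` and `D`: there is exactly one literal `u` with `u ∈ C` and
`u.compl ∈ D`, and `E = (C \ {u}) ∪ (D \ {u.compl})`. -/
def IsResolvent {V : Type*} [DecidableEq V] (E C D : Clause V) : Prop :=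
  ∃ u : Literal V, (∀ v : Literal V, (v ∈ C.lits ∧ Literal.compl v ∈ D.lits) ↔ v = u) ∧
    E.lits = (C.lits \ {u}) ∪ (D.lits \ {Literal.compl u})

/-- Finite binary trees whose vertices are labeled with clauses. -/
inductive ClauseTree (V : Type*) where
  | leaf (C : Clause V) : ClauseTree V
  | node (C : Clause V) (b c : ClauseTree V) : ClauseTree V

namespace ClauseTree

/-- The label of the root. -/
def label {V : Type*} : ClauseTree V → Clause V
  | leaf C => C
  | node C _ _ => C

/-- The list of the labels of the leaves, one entry for each leaf. -/
def leafLabels {V : Type*} : ClauseTree V → List (Clause V)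
  | leaf C => [C]
  | node _ b c => b.leafLabels ++ c.leafLabels

/-- The label of every inner vertex is the resolvent of the labels of its two children. -/
def ResolvesAtNodes {V : Type*} [DecidableEq V] : ClauseTree V → Prop
  | leaf _ => True
  | node C b c => IsResolvent C b.label c.label ∧ b.ResolvesAtNodes ∧ c.ResolvesAtNodes

/-- `T` is a resolution tree for the formula `F`. -/
structure IsResolutionTree {V : Type*} [DecidableEq V] (T : ClauseTree V) (F : Formula V) :
    Prop where
  leaves_mem : ∀ C ∈ T.leafLabels, C ∈ F
  root_empty : T.label.lits = ∅
  resolves : T.ResolvesAtNodes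

/-- No two leaves are labeled with the same clause. -/
def IsStrict {V : Type*} (T : ClauseTree V) : Prop := T.leafLabels.Nodup

end ClauseTree

/-- `F` has a strict resolution tree. -/
def Formula.IsStrictlyTreelike {V : Type*} [DecidableEq V] (F : Formula V) : Prop :=
  ∃ T : ClauseTree V, T.IsResolutionTree F ∧ T.IsStrict

/-- `tower a 0 = 1` and `tower a (n + 1) = a ^ tower a n` (for a base `a > 0`). -/
noncomputable def tower (a : ℝ) : ℕ → ℝ
  | 0 => 1
  | n + 1 => a ^ tower a n

end LinearCNF

/-! Let `a = 2 - ε > 1` and `a < b < 2`. In a strict resolution tree take the depth `i` maximizing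
(number of vertices at depth `i`) / `b ^ i`. Comparison with depth 0 gives at least `b ^ i` vertices
there; comparison with depth `i + 1` shows that a fraction at least `1 - b / 2` of them are leaves;
comparison with depth `i - s` bounds the ancestors at height `s` by a fraction `b ^ (-s)`.

Every literal of a leaf is resolved away on its path to the root. Two literals resolved at heights
`s < t` are determined by the ancestor at height `s`, so by weak linearity and strictness this
ancestor determines the leaf (`card_leavesWithLiteralsAt_le`). Summed over `t ≤ a ^ s` and `s ≥ H`,
such leaves form a fraction at most a tail of `∑ (a / b) ^ s`, which is below `1 - b / 2` for large
`H`. Some leaf at depth `i` therefore has `t > a ^ s` for all its heights `H ≤ s < t`. Its `k`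
heights grow like a tower, which forces `i` to be large, and there are at least `b ^ i` leaves with
distinct labels. -/

namespace LinearCNF

/-! ### Levels and leaves of binary trees -/

namespace ClauseTree

variable {V : Type*}

/-- The addresses of the vertices at depth `n`. -/
def level : ClauseTree V → ℕ → Finset (List Bool)
  | _, 0 => {[]}
  | leaf _, _ + 1 => ∅
  | node _ b c, n + 1 => (b.level n).image (List.cons true) ∪ (c.level n).image (List.cons false)

/-- The addresses of the leaves at depth `n`. -/
def leafLevel : ClauseTree V → ℕ → Finset (List Bool)
  | leaf _, 0 => {[]}
  | node _ _ _, 0 => ∅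
  | leaf _, _ + 1 => ∅
  | node _ b c, n + 1 =>
    (b.leafLevel n).image (List.cons true) ∪ (c.leafLevel n).image (List.cons false)

/-- The label of the vertex at a given address. -/
def labelAt : ClauseTree V → List Bool → Clause V
  | leaf C, _ => C
  | node C _ _, [] => C
  | node _ b _, true :: p => b.labelAt p
  | node _ _ c, false :: p => c.labelAt p

theorem card_image_cons_union (A B : Finset (List Bool)) :
    (A.image (List.cons true) ∪ B.image (List.cons false)).card = A.card + B.card := by
  rw [Finset.card_union_of_disjoint, Finset.card_image_of_injective _ List.cons_injective,
    Finset.card_image_of_injective _ List.cons_injective]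
  rw [Finset.disjoint_left]
  simp only [Finset.mem_image, not_exists, not_and, forall_exists_index, and_imp]
  rintro _ p _ rfl q _ h
  simp at h

theorem level_zero (T : ClauseTree V) : T.level 0 = {[]} := by
  cases T <;> simp [level]

/-- Each vertex at depth `n` that is not a leaf has two children. Slow growth to the next level thus
forces many leaves. -/
theorem card_level_succ (T : ClauseTree V) (n : ℕ) :
    (T.level (n + 1)).card + 2 * (T.leafLevel n).card = 2 * (T.level n).card := by
  induction T generalizing n with
  | leaf C => cases n <;> simp [level, leafLevel]
  | node C b c hb hc =>
    cases n with
    | zero => simp [level, leafLevel, level_zero]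
    | succ n =>
      have h1 := hb n
      have h2 := hc n
      rw [level, card_image_cons_union, leafLevel, card_image_cons_union, level,
        card_image_cons_union]
      omega

theorem leafLabels_length_pos (T : ClauseTree V) : 0 < T.leafLabels.length := by
  induction T with
  | leaf C => simp [leafLabels]
  | node C b c hb hc => simp only [leafLabels, List.length_append]; omega

theorem card_level_le_length (T : ClauseTree V) (n : ℕ) :
    (T.level n).card ≤ T.leafLabels.length := by
  induction T generalizing n with
  | leaf C => cases n <;> simp [level, leafLabels]
  | node C b c hb hc =>
    cases n with
    | zero => rw [level_zero]; exact leafLabels_length_pos _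
    | succ n =>
      rw [level, card_image_cons_union, leafLabels, List.length_append]
      exact Nat.add_le_add (hb n) (hc n)

theorem exists_level_eq_empty (T : ClauseTree V) : ∃ h, ∀ n, h ≤ n → T.level n = ∅ := by
  induction T with
  | leaf C =>
    refine ⟨1, fun n hn => ?_⟩
    obtain ⟨m, rfl⟩ := Nat.exists_eq_add_of_le' hn
    rfl
  | node C b c hb hc =>
    obtain ⟨h1, hb⟩ := hb
    obtain ⟨h2, hc⟩ := hc
    refine ⟨max h1 h2 + 1, fun n hn => ?_⟩
    obtain ⟨m, rfl⟩ : ∃ m, n = m + 1 := ⟨n - 1, by omega⟩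
    rw [level, hb m (by omega), hc m (by omega)]
    rfl

theorem leafLevel_subset_level (T : ClauseTree V) (n : ℕ) : T.leafLevel n ⊆ T.level n := by
  induction T generalizing n with
  | leaf C => cases n <;> simp [level, leafLevel]
  | node C b c hb hc =>
    cases n with
    | zero => simp [leafLevel]
    | succ n =>
      rw [level, leafLevel]
      exact Finset.union_subset_union (Finset.image_subset_image (hb n))
        (Finset.image_subset_image (hc n))

theorem take_mem_level (T : ClauseTree V) {n j : ℕ} (hj : j ≤ n) {p : List Bool}
    (hp : p ∈ T.level n) : p.take j ∈ T.level j := by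
  induction T generalizing n j p with
  | leaf C =>
    cases n with
    | zero =>
      obtain rfl : j = 0 := by omega
      simp [level]
    | succ n => simp [level] at hp
  | node C b c hb hc =>
    cases j with
    | zero => simp [level]
    | succ j =>
      obtain ⟨m, rfl⟩ : ∃ m, n = m + 1 := ⟨n - 1, by omega⟩
      simp only [level, Finset.mem_union, Finset.mem_image] at hp ⊢
      rcases hp with ⟨q, hq, rfl⟩ | ⟨q, hq, rfl⟩
      · exact Or.inl ⟨_, hb (by omega) hq, rfl⟩
      · exact Or.inr ⟨_, hc (by omega) hq, rfl⟩

theorem labelAt_mem_leafLabels (T : ClauseTree V) {n : ℕ} {p : List Bool}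
    (hp : p ∈ T.leafLevel n) : T.labelAt p ∈ T.leafLabels := by
  induction T generalizing n p with
  | leaf C => simp [labelAt, leafLabels]
  | node C b c hb hc =>
    cases n with
    | zero => simp [leafLevel] at hp
    | succ n =>
      simp only [leafLevel, Finset.mem_union, Finset.mem_image] at hp
      rw [leafLabels, List.mem_append]
      rcases hp with ⟨q, hq, rfl⟩ | ⟨q, hq, rfl⟩
      · exact Or.inl (hb hq)
      · exact Or.inr (hc hq)

theorem IsStrict.injOn_labelAt {T : ClauseTree V} (hT : T.IsStrict) (n : ℕ) :
    Set.InjOn T.labelAt (T.leafLevel n) := by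
  induction T generalizing n with
  | leaf C => cases n <;> simp [leafLevel]
  | node C b c hb hc =>
    cases n with
    | zero => simp [leafLevel]
    | succ n =>
      simp only [IsStrict, leafLabels, List.nodup_append'] at hT
      obtain ⟨h1, h2, h3⟩ := hT
      intro p hp q hq h
      simp only [leafLevel, Finset.coe_union, Finset.coe_image, Set.mem_union, Set.mem_image,
        Finset.mem_coe] at hp hq
      rcases hp with ⟨p, hp, rfl⟩ | ⟨p, hp, rfl⟩ <;> rcases hq with ⟨q, hq, rfl⟩ | ⟨q, hq, rfl⟩
      · rw [hb h1 n hp hq h]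
      · exact (h3 (labelAt_mem_leafLabels b hp) (by
          simp only [labelAt] at h
          rw [h]; exact labelAt_mem_leafLabels c hq)).elim
      · exact (h3 (labelAt_mem_leafLabels b hq) (by
          simp only [labelAt] at h
          rw [← h]; exact labelAt_mem_leafLabels c hp)).elim
      · rw [hc h2 n hp hq h]

/-! ### Resolved literals along paths -/

/-- The edges of a resolution tree can be labeled with literals such that every literal of a leaf
is a literal of the root or labels an edge on the path to the root; the edge above the vertex with
address `p` carries the label `lit p`. -/
theorem ResolvesAtNodes.exists_edge_labels [DecidableEq V] {T : ClauseTree V}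
    (hT : T.ResolvesAtNodes) : ∃ lit : List Bool → Option (Literal V),
      ∀ n, ∀ p ∈ T.leafLevel n, ∀ u ∈ (T.labelAt p).lits,
        u ∈ T.label.lits ∨ ∃ j < n, lit (p.take (j + 1)) = some u := by
  induction T with
  | leaf C => exact ⟨fun _ => none, fun n p _ u hu => Or.inl hu⟩
  | node C b c hb hc =>
    obtain ⟨⟨w, -, hw⟩, hTb, hTc⟩ := hT
    obtain ⟨f, hf⟩ := hb hTb
    obtain ⟨g, hg⟩ := hc hTc
    -- The edge above a child carries the literal which that child loses in the resolution. The
    -- values of `f` and `g` at `[]` are never used.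
    refine ⟨fun p => match p with
      | [] => none
      | [true] => some w
      | [false] => some (Literal.compl w)
      | true :: x :: p => f (x :: p)
      | false :: x :: p => g (x :: p), ?_⟩
    intro n p hp u hu
    cases n with
    | zero => simp [leafLevel] at hp
    | succ n =>
      simp only [leafLevel, Finset.mem_union, Finset.mem_image] at hp
      rcases hp with ⟨p, hp, rfl⟩ | ⟨p, hp, rfl⟩
      · rcases hf n p hp u hu with h | ⟨j, hj, h⟩
        · by_cases huw : u = w
          · exact Or.inr ⟨0, by omega, by simp [huw]⟩
          · left
            simp only [label, hw, Finset.mem_union, Finset.mem_sdiff, Finset.mem_singleton]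
            exact Or.inl ⟨h, huw⟩
        · refine Or.inr ⟨j + 1, by omega, ?_⟩
          -- A leaf with empty address has depth 0, which contradicts `j < n`.
          cases p with
          | nil =>
            cases n with
            | zero => omega
            | succ n => cases b <;> simp [leafLevel] at hp
          | cons x p => simpa using h
      · rcases hg n p hp u hu with h | ⟨j, hj, h⟩
        · by_cases huw : u = Literal.compl w
          · exact Or.inr ⟨0, by omega, by simp [huw]⟩
          · left
            simp only [label, hw, Finset.mem_union, Finset.mem_sdiff, Finset.mem_singleton]
            exact Or.inr ⟨h, huw⟩
        · refine Or.inr ⟨j + 1, by omega, ?_⟩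
          cases p with
          | nil =>
            cases n with
            | zero => omega
            | succ n => cases c <;> simp [leafLevel] at hp
          | cons x p => simpa using h

/-! ### Dominating levels and pairs of resolved literals -/

/-- In every tree there is a depth `i` that maximizes the number of vertices, discounted by `b`
per level. -/
theorem exists_dominating_level (T : ClauseTree V) {b : ℝ} (hb : 0 < b) :
    ∃ i, ∀ j, ((T.level j).card : ℝ) / b ^ j ≤ (T.level i).card / b ^ i := by
  obtain ⟨h, hh⟩ := T.exists_level_eq_empty
  obtain ⟨i, -, hi⟩ := Finset.exists_max_image (Finset.range (h + 1))
    (fun j => ((T.level j).card : ℝ) / b ^ j) ⟨0, by simp⟩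
  refine ⟨i, fun j => ?_⟩
  by_cases hj : j < h + 1
  · exact hi j (by simpa using hj)
  · rw [hh j (by omega)]
    simp only [Finset.card_empty, Nat.cast_zero, zero_div]
    positivity

/-- The leaves at depth `i` with two literals that label the edges at heights `s` and `t`
above the leaf. -/
def leavesWithLiteralsAt [DecidableEq V] (T : ClauseTree V)
    (lit : List Bool → Option (Literal V)) (i s t : ℕ) : Finset (List Bool) :=
  {p ∈ T.leafLevel i | ∃ x ∈ (T.labelAt p).lits, ∃ y ∈ (T.labelAt p).lits, x ≠ y ∧
    lit (p.take (i - s)) = some x ∧ lit (p.take (i - t)) = some y}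

/-- Truncation to the ancestor at height `s` is injective: as `s ≤ t`, this ancestor fixes both edge
labels, so two leaves below it share two literals, hence their clause, hence coincide by strictness.
-/
theorem card_leavesWithLiteralsAt_le [DecidableEq V] {F : Formula V} (hF : F.IsWeaklyLinear)
    {T : ClauseTree V} (hT : ∀ C ∈ T.leafLabels, C ∈ F) (hs : T.IsStrict)
    (lit : List Bool → Option (Literal V)) (i : ℕ) {s t : ℕ} (hst : s ≤ t) :
    (T.leavesWithLiteralsAt lit i s t).card ≤ (T.level (i - s)).card := by
  refine Finset.card_le_card_of_injOn (List.take (i - s)) ?_ ?_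
  · intro p hp
    simp only [leavesWithLiteralsAt, Finset.coe_filter, Set.mem_ofPred_eq] at hp
    exact T.take_mem_level (Nat.sub_le _ _) (T.leafLevel_subset_level i hp.1)
  · intro p hp q hq hpq
    simp only [leavesWithLiteralsAt, Finset.coe_filter, Set.mem_ofPred_eq] at hp hq
    obtain ⟨hp, x, hx, y, hy, hxy, h1, h2⟩ := hp
    obtain ⟨hq, x', hx', y', hy', -, h1', h2'⟩ := hq
    have hpq' : p.take (i - t) = q.take (i - t) := by
      have := congrArg (List.take (i - t)) hpq
      rwa [List.take_take, List.take_take, min_eq_left (by omega)] at this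
    obtain rfl : x = x' := by
      rw [hpq, h1'] at h1; exact (Option.some.inj h1).symm
    obtain rfl : y = y' := by
      rw [hpq', h2'] at h2; exact (Option.some.inj h2).symm
    refine hs.injOn_labelAt i hp hq ?_
    by_contra hne
    have h := hF _ (hT _ (T.labelAt_mem_leafLabels hp)) _ (hT _ (T.labelAt_mem_leafLabels hq)) hne
    rw [Finset.card_le_one] at h
    exact hxy (h x (Finset.mem_inter.2 ⟨hx, hx'⟩) y (Finset.mem_inter.2 ⟨hy, hy'⟩))

end ClauseTree

/-! ### Towers from exponential gaps -/

theorem tower_pos {a : ℝ} (ha : 0 < a) (n : ℕ) : 0 < tower a n := by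
  cases n with
  | zero => simp [tower]
  | succ n => exact Real.rpow_pos_of_pos ha _

theorem tower_le_one {a : ℝ} (ha : 0 < a) (ha' : a ≤ 1) (n : ℕ) : tower a n ≤ 1 := by
  cases n with
  | zero => simp [tower]
  | succ n => exact Real.rpow_le_one ha.le ha' (tower_pos ha n).le

theorem tower_succ_le_pow {a : ℝ} (ha : 1 ≤ a) {n m : ℕ} (h : tower a n ≤ m) :
    tower a (n + 1) ≤ a ^ m := by
  rw [tower, ← Real.rpow_natCast]
  exact Real.rpow_le_rpow_of_exponent_le ha h

/-- A set of positive integers with exponential gaps reaches the height of a tower. -/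
theorem exists_tower_le_of_gaps {a : ℝ} (ha : 1 ≤ a) (n : ℕ) (P : Finset ℕ)
    (hP : n < P.card) (hpos : ∀ s ∈ P, 1 ≤ s)
    (hgap : ∀ s ∈ P, ∀ t ∈ P, s < t → a ^ s < (t : ℝ)) : ∃ s ∈ P, tower a n ≤ (s : ℝ) := by
  induction n generalizing P with
  | zero =>
    obtain ⟨s, hs⟩ := Finset.card_pos.1 hP
    exact ⟨s, hs, by simpa [tower] using hpos s hs⟩
  | succ n ih =>
    have hne : P.Nonempty := Finset.card_pos.1 (by omega)
    have hmax := P.max'_mem hne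
    -- Without its maximum the set still reaches `tower a n`; the last gap adds one exponentiation.
    obtain ⟨s, hs, h⟩ := ih (P.erase (P.max' hne)) (by rw [Finset.card_erase_of_mem hmax]; omega)
      (fun s hs => hpos s (Finset.mem_of_mem_erase hs))
      (fun s hs t ht => hgap s (Finset.mem_of_mem_erase hs) t (Finset.mem_of_mem_erase ht))
    refine ⟨_, hmax, (tower_succ_le_pow ha h).trans (hgap s (Finset.mem_of_mem_erase hs) _ hmax ?_).le⟩
    exact lt_of_le_of_ne (P.le_max' s (Finset.mem_of_mem_erase hs)) (Finset.ne_of_mem_erase hs)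

theorem sum_Ico_geometric_le {r : ℝ} (hr : 0 ≤ r) (hr' : r < 1) (m n : ℕ) :
    ∑ s ∈ Finset.Ico m n, r ^ s ≤ r ^ m * (1 - r)⁻¹ := by
  rw [Finset.sum_Ico_eq_sum_range]
  simp_rw [pow_add]
  rw [← Finset.mul_sum]
  refine mul_le_mul_of_nonneg_left ?_ (by positivity)
  rw [← tsum_geometric_of_lt_one hr hr']
  exact (summable_geometric_of_lt_one hr hr').sum_le_tsum _ (fun _ _ => by positivity)

/-! ### A leaf with exponentially spread heights -/

/-- The number of leaves at a dominating depth two of whose literals are resolved at heights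
`s < t ≤ a ^ s` with `s ≥ H`. -/
theorem card_biUnion_leavesWithLiteralsAt_le {V : Type*} [DecidableEq V] {F : Formula V}
    (hF : F.IsWeaklyLinear) {T : ClauseTree V} (hT : ∀ C ∈ T.leafLabels, C ∈ F)
    (hs : T.IsStrict) (lit : List Bool → Option (Literal V)) {a b : ℝ} (ha : 1 < a) (hab : a < b)
    {i : ℕ} (hi : ∀ j, ((T.level j).card : ℝ) / b ^ j ≤ (T.level i).card / b ^ i) (H : ℕ) :
    (((Finset.Ico H i).biUnion fun s => (Finset.Ioc s ⌊a ^ s⌋₊).biUnion fun t =>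
      T.leavesWithLiteralsAt lit i s t).card : ℝ) ≤
      (T.level i).card * ((a / b) ^ H * (1 - a / b)⁻¹) := by
  have hb : 0 < b := by linarith
  calc _ ≤ ((∑ s ∈ Finset.Ico H i, ∑ t ∈ Finset.Ioc s ⌊a ^ s⌋₊, (T.level (i - s)).card : ℕ) : ℝ) := by
        refine Nat.cast_le.2 (Finset.card_biUnion_le.trans (Finset.sum_le_sum fun s _ => ?_))
        refine Finset.card_biUnion_le.trans (Finset.sum_le_sum fun t ht => ?_)
        exact ClauseTree.card_leavesWithLiteralsAt_le hF hT hs lit i (Finset.mem_Ioc.1 ht).1.le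
    _ ≤ ∑ s ∈ Finset.Ico H i, (T.level i).card * (a / b) ^ s := by
        push_cast
        refine Finset.sum_le_sum fun s hs => ?_
        rw [Finset.sum_const, Nat.card_Ioc, nsmul_eq_mul]
        have h1 : ((⌊a ^ s⌋₊ - s : ℕ) : ℝ) ≤ a ^ s :=
          (Nat.cast_le.2 (Nat.sub_le _ _)).trans (Nat.floor_le (by positivity))
        have h2 : ((T.level (i - s)).card : ℝ) ≤ (T.level i).card / b ^ s := by
          have h := hi (i - s)
          have hsi : i - s + s = i := Nat.sub_add_cancel (Finset.mem_Ico.1 hs).2.le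
          rw [← hsi] at h
          simp only [Nat.add_sub_cancel] at h
          rw [pow_add, div_le_div_iff₀ (by positivity) (by positivity)] at h
          rw [hsi] at h
          rw [le_div_iff₀ (by positivity)]
          refine le_of_mul_le_mul_right ?_ (pow_pos hb (i - s))
          linarith
        calc _ ≤ a ^ s * ((T.level i).card / b ^ s) :=
              mul_le_mul h1 h2 (by positivity) (by positivity)
          _ = _ := by rw [div_pow]; ring
    _ ≤ _ := by
        rw [← Finset.mul_sum]
        exact mul_le_mul_of_nonneg_left (sum_Ico_geometric_le (div_nonneg (by linarith) hb.le)
          ((div_lt_one hb).2 hab) H i) (by positivity)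

/-- If the literals of a leaf at depth `i` label edges on the path to the root, and those at heights
`s < t` with `s ≥ H` satisfy `a ^ s < t`, then the depth of the leaf exceeds a tower. -/
theorem exists_tower_le_of_leaf {α : Type*} {a : ℝ} (ha : 1 ≤ a) {H i n : ℕ}
    (hH : 1 ≤ H) (C : Finset α) (hC : H + n < C.card) (f : ℕ → Option α)
    (hf : ∀ u ∈ C, ∃ j < i, f (j + 1) = some u)
    (hgap : ∀ s t, H ≤ s → s < t → t < i → (t : ℝ) ≤ a ^ s →
      ∀ x ∈ C, ∀ y ∈ C, x ≠ y → f (i - s) = some x → f (i - t) ≠ some y) :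
    ∃ s < i, tower a n ≤ (s : ℝ) := by
  have hf' : ∀ u : C, ∃ s < i, f (i - s) = some u.1 := fun u => by
    obtain ⟨j, hj, h⟩ := hf u.1 u.2
    -- The height of an edge is measured from the leaf to the lower end of the edge, so it can be 0.
    exact ⟨i - (j + 1), by omega, by rwa [Nat.sub_sub_self (by omega)]⟩
  choose g hg hfg using hf'
  have hinj : Function.Injective g := fun u v h => by
    have h1 := hfg u
    rw [h, hfg v] at h1
    exact Subtype.ext (Option.some.inj h1).symm
  have hcard : (Finset.univ.image g).card = C.card := by
    rw [Finset.card_image_of_injective _ hinj]; simp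
  -- Only `H` heights lie below `H`; those that remain are positive because `1 ≤ H`.
  have hsplit : n < ((Finset.univ.image g) \ Finset.range H).card := by
    have := Finset.le_card_sdiff (Finset.range H) (Finset.univ.image g)
    rw [Finset.card_range] at this
    omega
  obtain ⟨s, hs, h⟩ := exists_tower_le_of_gaps ha n _ hsplit
    (fun s hs => by
      simp only [Finset.mem_sdiff, Finset.mem_range] at hs
      omega)
    (fun s hs t ht hst => by
      simp only [Finset.mem_sdiff, Finset.mem_image, Finset.mem_univ, true_and,
        Finset.mem_range, not_lt] at hs ht
      obtain ⟨⟨u, rfl⟩, hu⟩ := hs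
      obtain ⟨⟨v, rfl⟩, hv⟩ := ht
      by_contra! hle
      refine hgap _ _ hu hst (hg v) hle u u.2 v v.2 ?_ (hfg u) (hfg v)
      intro huv
      rw [Subtype.ext huv] at hst
      exact lt_irrefl _ hst)
  simp only [Finset.mem_sdiff, Finset.mem_image, Finset.mem_univ, true_and] at hs
  obtain ⟨⟨u, rfl⟩, -⟩ := hs
  exact ⟨_, hg u, h⟩

/-- In `hsmall` the left side bounds the fraction of bad leaves at the dominating depth, and the
right side is the guaranteed fraction of leaves. -/
theorem tower_le_card_of_isStrictlyTreelike {V : Type*} [DecidableEq V] {F : Formula V}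
    {a b : ℝ} (ha : 1 < a) (hab : a < b) {H n : ℕ} (hH : 1 ≤ H)
    (hsmall : (a / b) ^ H * (1 - a / b)⁻¹ < 1 - b / 2) (hk : F.IsKCNF (H + (n + 1)))
    (hF : F.IsWeaklyLinear) (hT : F.IsStrictlyTreelike) : tower a (n + 1) ≤ (F.card : ℝ) := by
  obtain ⟨T, ⟨hmem, hroot, hres⟩, hs⟩ := hT
  have hb : 1 < b := ha.trans hab
  obtain ⟨lit, hlit⟩ := hres.exists_edge_labels
  obtain ⟨i, hi⟩ := T.exists_dominating_level (zero_lt_one.trans hb)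
  have hlevel : b ^ i ≤ ((T.level i).card : ℝ) := by
    have h := hi 0
    rw [T.level_zero, le_div_iff₀ (by positivity)] at h
    simpa using h
  have hpos : 0 < ((T.level i).card : ℝ) := lt_of_lt_of_le (by positivity) hlevel
  have hleaf : ((T.level i).card : ℝ) * (1 - b / 2) ≤ (T.leafLevel i).card := by
    have h := hi (i + 1)
    rw [div_le_div_iff₀ (by positivity) (by positivity), pow_succ] at h
    have h' : ((T.level (i + 1)).card : ℝ) ≤ (T.level i).card * b :=
      le_of_mul_le_mul_right (by linarith) (pow_pos (zero_lt_one.trans hb) i)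
    have h2 : ((T.level (i + 1)).card : ℝ) + 2 * (T.leafLevel i).card = 2 * (T.level i).card := by
      exact_mod_cast T.card_level_succ i
    linarith
  obtain ⟨p, hp, hgood⟩ : ∃ p ∈ T.leafLevel i, p ∉ (Finset.Ico H i).biUnion fun s =>
      (Finset.Ioc s ⌊a ^ s⌋₊).biUnion fun t => T.leavesWithLiteralsAt lit i s t := by
    refine Finset.exists_mem_notMem_of_card_lt_card ?_
    rw [← Nat.cast_lt (α := ℝ)]
    exact ((card_biUnion_leavesWithLiteralsAt_le hF hmem hs lit ha hab hi H).trans_lt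
      (mul_lt_mul_of_pos_left hsmall hpos)).trans_le hleaf
  obtain ⟨s, hsi, h⟩ := exists_tower_le_of_leaf ha.le (n := n) (i := i) hH (T.labelAt p).lits
    (by rw [hk _ (hmem _ (T.labelAt_mem_leafLabels hp))]; omega) (fun j => lit (p.take j))
    (fun u hu => (hlit i p hp u hu).resolve_left (by simp [hroot]))
    (fun s t hHs hst hti hle x hx y hy hxy h1 h2 => hgood (by
      simp only [Finset.mem_biUnion, Finset.mem_Ico, Finset.mem_Ioc]
      exact ⟨s, ⟨hHs, hst.trans hti⟩, t, ⟨hst, Nat.le_floor hle⟩,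
        Finset.mem_filter.2 ⟨hp, x, hx, y, hy, hxy, h1, h2⟩⟩))
  have hlen : T.leafLabels.length ≤ F.card :=
    Finset.card_le_card (s := ⟨(T.leafLabels : Multiset (Clause V)), Multiset.coe_nodup.2 hs⟩) (fun C hC => hmem C (Multiset.mem_coe.1 hC))
  calc tower a (n + 1) ≤ a ^ s := tower_succ_le_pow ha.le h
    _ ≤ a ^ i := pow_le_pow_right₀ ha.le hsi.le
    _ ≤ b ^ i := pow_le_pow_left₀ (by linarith) hab.le i
    _ ≤ (T.level i).card := hlevel
    _ ≤ F.card := Nat.cast_le.2 ((T.card_level_le_length i).trans hlen)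

theorem Formula.IsStrictlyTreelike.card_pos {V : Type*} [DecidableEq V] {F : Formula V}
    (hF : F.IsStrictlyTreelike) : 0 < F.card := by
  obtain ⟨T, hT, -⟩ := hF
  obtain ⟨C, hC⟩ := List.exists_mem_of_length_pos T.leafLabels_length_pos
  exact Finset.card_pos.2 ⟨C, hT.leaves_mem C hC⟩

end LinearCNF

/-- `k - c` is truncated at `0`, so that for `k < c` the bound reads `1 ≤ F.card`. The hypothesis
`ε < 2` makes the base `2 - ε` positive, so that its real powers are meaningful. -/
theorem theorem4 (ε : ℝ) (hε : 0 < ε) (hε' : ε < 2) :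
    ∃ c : ℕ, ∀ (k : ℕ) (V : Type*) [DecidableEq V] (F : LinearCNF.Formula V),
      F.IsKCNF k → F.IsWeaklyLinear → F.IsStrictlyTreelike →
        LinearCNF.tower (2 - ε) (k - c) ≤ (F.card : ℝ) := by
  -- For base at most 1 every tower is at most 1; the main argument needs base above 1.
  rcases le_or_gt 1 ε with h1 | h1
  · refine ⟨0, fun k V _ F _ _ hT => ?_⟩
    exact (LinearCNF.tower_le_one (by linarith) (by linarith) _).trans
      (Nat.one_le_cast.2 hT.card_pos)
  -- Here `b = 2 - ε / 2` is the midpoint between `a` and 2.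
  · have hab : 2 - ε < 2 - ε / 2 := by linarith
    have hr0 : 0 ≤ (2 - ε) / (2 - ε / 2) := div_nonneg (by linarith) (by linarith)
    have hr : (2 - ε) / (2 - ε / 2) < 1 := (div_lt_one (by linarith)).2 hab
    have hlim : Filter.Tendsto (fun H : ℕ => ((2 - ε) / (2 - ε / 2)) ^ H *
        (1 - (2 - ε) / (2 - ε / 2))⁻¹) Filter.atTop (nhds 0) := by
      simpa using (tendsto_pow_atTop_nhds_zero_of_lt_one hr0 hr).mul_const _
    obtain ⟨H, hsmall, hH⟩ := ((hlim.eventually_lt_const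
      (show (0 : ℝ) < 1 - (2 - ε / 2) / 2 by linarith)).and (Filter.eventually_ge_atTop 1)).exists
    refine ⟨H, fun k V _ F hk hF hT => ?_⟩
    rcases le_or_gt k H with hkH | hkH
    · rw [Nat.sub_eq_zero_of_le hkH, LinearCNF.tower]
      exact Nat.one_le_cast.2 hT.card_pos
    · obtain ⟨n, rfl⟩ : ∃ n, k = H + (n + 1) := ⟨k - H - 1, by omega⟩
      rw [Nat.add_sub_cancel_left]
      exact LinearCNF.tower_le_card_of_isStrictlyTreelike (by linarith) hab hH hsmall hk hF hT
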